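/- **Setting.** Let $(M,\omega)$ be a compact symplectic manifold without boundary. Let $H,F:S^1\times M\to\mathbb R$ ($S^1=\mathbb R/\mathbb Z$) be smooth time-periodic Hamiltonians, with Hamiltonian vector fields given by $\omega(X_H,\cdot)=dH_t$, $\omega(X_F,\cdot)=dF_t$. Let $J^0=\{J^0_t\}$ and $J^1=\{J^1_t\}$ be families of $\omega$-compatible almost complex structures, smooth in $(t,x)\in[0,1]\times M$ and $1$-periodic in $t$. Put $$(X_{(H,F)},J)=\begin{cases}(X_H,J^0), & \tau<0,\\ (X_F,J^1), & \tau>0,\end{cases}\qquad |v|_J^2=\omega(v,Jv).$$ (A particular case is $J^0_t=(\phi_H^t)_*J'_t$, $J^1_t=(\phi_F^t)_*J'_t$, when $\phi_H^1=\phi_F^1=\phi$ and $J'$ is a smooth path of compatible almost complex structures with $J'_1=\phi^*J'_0$.) For a loop $z:S^1\to M$ bounding a smooth disc $w:D^2\to M$, $w(e^{2\pi it})=z(t)$, put $$\mathcal A_H([z,w])=-\int w^*\omega-\int_0^1H_t(z(t))\,dt .$$ **Theorem.** Let $[z^-,w^-]$ be a critical point of $\mathcal A_H$ and $[z^+,w^+]$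 a critical point of $\mathcal A_F$. Let $u:\mathbb R\times S^1\to M$ be a map that is smooth on $\{\tau<0\}$ and on $\{\tau>0\}$ (no condition is imposed along $\tau=0$), solves $$\frac{\partial u}{\partial\tau}+J\Big(\frac{\partial u}{\partial t}-X_{(H,F)}(u)\Big)=0\qquad\text{for }\tau\ne0,$$ has finite energy $$\int\!\!\int\Big(\Big|\frac{\partial u}{\partial\tau}\Big|_J^2+\Big|\frac{\partial u}{\partial t}-X_{(H,F)}(u)\Big|_J^2\Big)\,dt\,d\tau<\infty,$$ and satisfies $u(\tau,\cdot)\to z^{\pm}$ uniformly as $\tau\to\pm\infty$. Let $u_-$ and $u_+$ be the restrictions of $u$ to $\tau<0$ and $\tau>0$. Then the (improper) integrals $$\int u_-^*\omega=\lim_{R\to\infty,\ \epsilon\to0^+}\int_{[-R,-\epsilon]\times S^1}u^*\omega,\qquad \int u_+^*\omega=\lim_{R\to\infty,\ \epsilon\to0^+}\int_{[\epsilon,R]\times S^1}u^*\omega$$ converge, and if $$\int (w^-)^*\omega+\int u_-^*\omega+\int u_+^*\omega-\int (w^+)^*\omega=0,$$ then $$\int\Big|\frac{\partial u}{\partial\tau}\Big|^2_{J}\,dt\,d\tau\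 \le\ \mathcal A_H([z^-,w^-])-\mathcal A_F([z^+,w^+])+\int_0^1\max_M H_t\,dt+\int_0^1-\min_M F_t\,dt .$$ -/

import Mathlib

open Set Filter Topology MeasureTheory
open scoped Manifold ContDiff

noncomputable section

namespace JumpingFloer

section Forms

variable {E : Type*} [NormedAddCommGroup E] [NormedSpace ℝ E]
  {M : Type*} [TopologicalSpace M] [ChartedSpace E M]

/-- The coordinate expression of a `2`-form on `M` in the preferred chart at `x₀`. -/
def chartForm (Ω : ∀ x : M, (TangentSpace 𝓘(ℝ, E) x) [⋀^Fin 2]→L[ℝ] ℝ) (x₀ : M) :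
    E → E [⋀^Fin 2]→L[ℝ] ℝ :=
  fun y => (Ω ((extChartAt 𝓘(ℝ, E) x₀).symm y)).compContinuousLinearMap
    (mfderiv 𝓘(ℝ, E) 𝓘(ℝ, E) (extChartAt 𝓘(ℝ, E) x₀).symm y)

variable (E M) in
/-- A symplectic form: a smooth closed nondegenerate `2`-form on `M`.  Smoothness and closedness
are checked in the preferred charts, which cover `M`. -/
structure SymplecticForm where
  /-- the alternating bilinear form on each tangent space -/
  form : ∀ x : M, (TangentSpace 𝓘(ℝ, E) x) [⋀^Fin 2]→L[ℝ] ℝ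
  smooth : ∀ x₀ : M, ContDiffOn ℝ ∞ (chartForm form x₀) (extChartAt 𝓘(ℝ, E) x₀).target
  closed : ∀ x₀ : M, ∀ y ∈ (extChartAt 𝓘(ℝ, E) x₀).target, extDeriv (chartForm form x₀) y = 0
  nondegenerate : ∀ (x : M) (v : TangentSpace 𝓘(ℝ, E) x),
    (∀ v' : TangentSpace 𝓘(ℝ, E) x, form x ![v, v'] = 0) → v = 0

/-- Every covector is `Ω(X, ·)` for a unique tangent vector `X`. -/
theorem SymplecticForm.existsUnique_vector [FiniteDimensional ℝ E] (Ω : SymplecticForm E M)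
    (x : M) (α : TangentSpace 𝓘(ℝ, E) x →L[ℝ] ℝ) :
    ∃! X : TangentSpace 𝓘(ℝ, E) x, ∀ v, Ω.form x ![X, v] = α v := by
  let f : E [⋀^Fin 2]→L[ℝ] ℝ := Ω.form x
  have h0 : ∀ a b c : E, Function.update ![a, b] 0 c = ![c, b] := fun a b c => by
    ext i; fin_cases i <;> rfl
  have h1 : ∀ a b c : E, Function.update ![a, b] 1 c = ![a, c] := fun a b c => by
    ext i; fin_cases i <;> rfl
  let B : E →ₗ[ℝ] Module.Dual ℝ E := LinearMap.mk₂ ℝ (fun v w => f ![v, w])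
    (fun v v' w => by simpa only [h0] using f.map_update_add ![v, w] 0 v v')
    (fun c v w => by simpa only [h0] using f.map_update_smul ![v, w] 0 c v)
    (fun v w w' => by simpa only [h1] using f.map_update_add ![v, w] 1 w w')
    (fun c v w => by simpa only [h1] using f.map_update_smul ![v, w] 1 c w)
  have hinj : Function.Injective B := by
    rw [injective_iff_map_eq_zero]
    intro v hv
    exact Ω.nondegenerate x v fun w => LinearMap.congr_fun hv w
  have hsurj : Function.Surjective B :=
    (LinearMap.injective_iff_surjective_of_finrank_eq_finrank
      (Subspace.dual_finrank_eq (K := ℝ) (V := E)).symm).1 hinj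
  obtain ⟨X, hX⟩ := hsurj (α : E →L[ℝ] ℝ).toLinearMap
  refine ⟨X, fun v => LinearMap.congr_fun hX v, fun Y hY => hinj ?_⟩
  ext v
  exact (hY v).trans (LinearMap.congr_fun hX v).symm

/-- The Hamiltonian vector field of `h : M → ℝ`, given by `Ω(X_h, ·) = dh`. -/
def hamiltonianVectorField [FiniteDimensional ℝ E] (Ω : SymplecticForm E M) (h : M → ℝ) (x : M) :
    TangentSpace 𝓘(ℝ, E) x :=
  (Ω.existsUnique_vector x (mfderiv 𝓘(ℝ, E) 𝓘(ℝ, ℝ) h x)).choose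

theorem form_hamiltonianVectorField [FiniteDimensional ℝ E] (Ω : SymplecticForm E M) (h : M → ℝ)
    (x : M) (v : TangentSpace 𝓘(ℝ, E) x) :
    Ω.form x ![hamiltonianVectorField Ω h x, v] = mfderiv 𝓘(ℝ, E) 𝓘(ℝ, ℝ) h x v :=
  (Ω.existsUnique_vector x (mfderiv 𝓘(ℝ, E) 𝓘(ℝ, ℝ) h x)).choose_spec.1 v

variable (E) in
/-- A smooth `1`-periodic time-dependent Hamiltonian, that is, a smooth function on `S¹ × M`. -/
structure IsPeriodicHamiltonian (H : ℝ → M → ℝ) : Prop where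
  smooth : ContMDiff (𝓘(ℝ, ℝ).prod 𝓘(ℝ, E)) 𝓘(ℝ, ℝ) ∞ (fun p : ℝ × M => H p.1 p.2)
  periodic : ∀ t x, H (t + 1) x = H t x

/-- A `1`-periodic family `J_t` of `Ω`-compatible almost complex structures, smooth in
`(t, x)` for `t ∈ [0, 1]`.  Periodicity only asks that the values at `t = 0` and `t = 1` agree,
not that the periodic extension is differentiable in `t` at the integers. -/
structure IsCompatibleFamily [IsManifold 𝓘(ℝ, E) ∞ M] (Ω : SymplecticForm E M)
    (J : ℝ → ∀ x : M, TangentSpace 𝓘(ℝ, E) x →L[ℝ] TangentSpace 𝓘(ℝ, E) x) : Prop where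
  smooth : ContMDiffOn (𝓘(ℝ, ℝ).prod 𝓘(ℝ, E).tangent) 𝓘(ℝ, E).tangent ∞
    (fun p : ℝ × TangentBundle 𝓘(ℝ, E) M =>
      (⟨p.2.proj, J p.1 p.2.proj p.2.snd⟩ : TangentBundle 𝓘(ℝ, E) M))
    (Icc 0 1 ×ˢ univ)
  periodic : ∀ t x, J (t + 1) x = J t x
  sq_eq_neg : ∀ t x (v : TangentSpace 𝓘(ℝ, E) x), J t x (J t x v) = -v
  invariant : ∀ t x (v v' : TangentSpace 𝓘(ℝ, E) x),
    Ω.form x ![J t x v, J t x v'] = Ω.form x ![v, v']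
  positive : ∀ t x (v : TangentSpace 𝓘(ℝ, E) x), v ≠ 0 → 0 < Ω.form x ![v, J t x v]

end Forms

section Action

variable {E : Type*} [NormedAddCommGroup E] [NormedSpace ℝ E]
  {M : Type*} [TopologicalSpace M] [ChartedSpace E M]

variable (E) in
/-- A smooth disc in `M`: a map that is smooth on the closed unit disc of `ℂ`
(its values elsewhere play no role). -/
def IsSmoothDisc (w : ℂ → M) : Prop :=
  ContMDiffOn 𝓘(ℝ, ℂ) 𝓘(ℝ, E) ∞ w (Metric.closedBall 0 1)

/-- The boundary loop `t ↦ w(e^{2πit})` of a disc. -/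
def boundaryLoop (w : ℂ → M) (t : ℝ) : M :=
  w (Complex.exp (2 * Real.pi * t * Complex.I))

/-- The symplectic area `∫ w^*Ω` of a disc, for the standard orientation `dx ∧ dy`. -/
def discArea (Ω : SymplecticForm E M) (w : ℂ → M) : ℝ :=
  ∫ ζ in Metric.ball (0 : ℂ) 1,
    Ω.form (w ζ) ![mfderiv 𝓘(ℝ, ℂ) 𝓘(ℝ, E) w ζ (1 : ℂ),
      mfderiv 𝓘(ℝ, ℂ) 𝓘(ℝ, E) w ζ Complex.I]

/-- The action `𝒜_H([z, w]) = -∫ w^*Ω - ∫₀¹ H(t, z(t)) dt` of a loop `z` bounding the disc `w`;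
the pair is encoded by `w`, whose boundary loop is `z`. -/
def action (Ω : SymplecticForm E M) (H : ℝ → M → ℝ) (w : ℂ → M) : ℝ :=
  -discArea Ω w - ∫ t in (0 : ℝ)..1, H t (boundaryLoop w t)

/-- `[z, w]` is a critical point of `𝒜_H`: the first variation of the action vanishes along every
smooth one-parameter family of discs through `w`. -/
def IsCriticalPoint (Ω : SymplecticForm E M) (H : ℝ → M → ℝ) (w : ℂ → M) : Prop :=
  ∀ W : ℝ × ℂ → M,
    ContMDiffOn 𝓘(ℝ, ℝ × ℂ) 𝓘(ℝ, E) ∞ W (univ ×ˢ Metric.closedBall 0 1) →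
    (∀ ζ ∈ Metric.closedBall (0 : ℂ) 1, W (0, ζ) = w ζ) →
    HasDerivAt (fun s : ℝ => action Ω H (fun ζ => W (s, ζ))) 0 0

end Action

section Maps

variable {E : Type*} [NormedAddCommGroup E] [NormedSpace ℝ E]
  {M : Type*} [TopologicalSpace M] [ChartedSpace E M]

variable (E) in
/-- The partial derivative `∂u/∂τ` of `u = u(τ, t)`. -/
def partialTau (u : ℝ × ℝ → M) (p : ℝ × ℝ) : TangentSpace 𝓘(ℝ, E) (u p) :=
  mfderiv 𝓘(ℝ, ℝ) 𝓘(ℝ, E) (fun s : ℝ => u (s, p.2)) p.1 (1 : ℝ)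

variable (E) in
/-- The partial derivative `∂u/∂t` of `u = u(τ, t)`. -/
def partialT (u : ℝ × ℝ → M) (p : ℝ × ℝ) : TangentSpace 𝓘(ℝ, E) (u p) :=
  mfderiv 𝓘(ℝ, ℝ) 𝓘(ℝ, E) (fun s : ℝ => u (p.1, s)) p.2 (1 : ℝ)

/-- The family in `τ` that jumps from `a` to `b` at `τ = 0`. -/
def jump {α : Sort*} (a b : α) (τ : ℝ) : α :=
  if τ < 0 then a else b

/-- `X_{(H,F)}(τ, t, x)`: equal to `X_H(t, x)` for `τ < 0` and to `X_F(t, x)` for `τ > 0`. -/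
def jumpVectorField [FiniteDimensional ℝ E] (Ω : SymplecticForm E M) (H F : ℝ → M → ℝ)
    (τ t : ℝ) (x : M) : TangentSpace 𝓘(ℝ, E) x :=
  hamiltonianVectorField Ω (jump H F τ t) x

/-- The square `|v|²_J = Ω(v, J v)` of the norm of a tangent vector. -/
def normSq (Ω : SymplecticForm E M) {x : M}
    (J : TangentSpace 𝓘(ℝ, E) x →L[ℝ] TangentSpace 𝓘(ℝ, E) x)
    (v : TangentSpace 𝓘(ℝ, E) x) : ℝ :=
  Ω.form x ![v, J v]

variable (E) in
/-- A map from `ℝ × S¹`, `S¹ = ℝ/ℤ`, to `M`, written as a map of `(τ, t)` that is `1`-periodic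
in `t`, smooth on `τ < 0` and on `τ > 0`; nothing is asked at `τ = 0`. -/
structure IsPiecewiseSmoothCylinder (u : ℝ × ℝ → M) : Prop where
  periodic : ∀ τ t, u (τ, t + 1) = u (τ, t)
  smooth : ContMDiffOn 𝓘(ℝ, ℝ × ℝ) 𝓘(ℝ, E) ∞ u {p | p.1 ≠ 0}

/-- `∂u/∂τ + J(∂u/∂t - X_{(H,F)}(u)) = 0` off the circle `τ = 0`, where `J` is `J₀` for `τ < 0`
and `J₁` for `τ > 0`. -/
def SolvesJumpingEquation [FiniteDimensional ℝ E] (Ω : SymplecticForm E M) (H F : ℝ → M → ℝ)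
    (J₀ J₁ : ℝ → ∀ x : M, TangentSpace 𝓘(ℝ, E) x →L[ℝ] TangentSpace 𝓘(ℝ, E) x)
    (u : ℝ × ℝ → M) : Prop :=
  ∀ p : ℝ × ℝ, p.1 ≠ 0 →
    partialTau E u p +
      jump J₀ J₁ p.1 p.2 (u p) (partialT E u p - jumpVectorField Ω H F p.1 p.2 (u p)) = 0

/-- Finite energy: `∫∫ (|∂u/∂τ|² + |∂u/∂t - X_{(H,F)}(u)|²) dt dτ < ∞`. -/
def HasFiniteEnergy [FiniteDimensional ℝ E] (Ω : SymplecticForm E M) (H F : ℝ → M → ℝ)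
    (J₀ J₁ : ℝ → ∀ x : M, TangentSpace 𝓘(ℝ, E) x →L[ℝ] TangentSpace 𝓘(ℝ, E) x)
    (u : ℝ × ℝ → M) : Prop :=
  IntegrableOn (fun p : ℝ × ℝ =>
    normSq Ω (jump J₀ J₁ p.1 p.2 (u p)) (partialTau E u p) +
    normSq Ω (jump J₀ J₁ p.1 p.2 (u p)) (partialT E u p - jumpVectorField Ω H F p.1 p.2 (u p)))
    (univ ×ˢ Ioc 0 1)

/-- `u(τ, ·) → z` as `τ` tends along `l`, uniformly on the circle (in the compact-open
topology, without choosing a metric on `M`). -/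
def ConvergesTo (u : ℝ × ℝ → M) (l : Filter ℝ) (z : ℝ → M) : Prop :=
  ∀ t₀ : ℝ, Tendsto u (l ×ˢ 𝓝 t₀) (𝓝 (z t₀))

/-- The symplectic area `∫ u^*Ω` of the part `τ ∈ [a, b]` of a cylinder, for the orientation
`dτ ∧ dt`. -/
def cylinderArea (Ω : SymplecticForm E M) (u : ℝ × ℝ → M) (a b : ℝ) : ℝ :=
  ∫ τ in a..b, ∫ t in (0 : ℝ)..1, Ω.form (u (τ, t)) ![partialTau E u (τ, t), partialT E u (τ, t)]

/-- `∫ (u₋)^*Ω = A`, where `u₋` is the part of `u` on `τ < 0`: the improper integral converges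
to `A` at both ends. -/
def HasNegativeArea (Ω : SymplecticForm E M) (u : ℝ × ℝ → M) (A : ℝ) : Prop :=
  Tendsto (fun q : ℝ × ℝ => cylinderArea Ω u q.1 q.2) (atBot ×ˢ 𝓝[<] 0) (𝓝 A)

/-- `∫ (u₊)^*Ω = A`, where `u₊` is the part of `u` on `τ > 0`: the improper integral converges
to `A` at both ends. -/
def HasPositiveArea (Ω : SymplecticForm E M) (u : ℝ × ℝ → M) (A : ℝ) : Prop :=
  Tendsto (fun q : ℝ × ℝ => cylinderArea Ω u q.1 q.2) (𝓝[>] 0 ×ˢ atTop) (𝓝 A)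

end Maps

end JumpingFloer

end

/-! For a solution, `floer_identities` gives the pointwise identity u^*ω(∂τ, ∂t) = |∂τ u|² - dh(∂τ
u), with h = H_t for τ < 0 and h = F_t for τ > 0. Integrated over a strip on one side of the jump,
area equals energy minus the change of the circle average of the Hamiltonian. The averages converge
at τ = ±∞ because u converges to the asymptotic loops.

The delicate end is τ = 0, where u need not extend. Compactness of M gives dh(v)² ≤ K|v|²
(`exists_differential_sq_le`), hence |dh(∂τ u)| ≤ |K| + |∂τ u|², which is integrable on bounded
strips. The averages are therefore primitives of integrable functions and have one-sided limits L₀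
and L₁ (`exists_tendsto_average`, `half_cylinder`), so both areas converge. Under the area
condition, adding the two sides gives energy = A_H - A_F + L₀ - L₁. The circle averages satisfy L₀ ≤
∫ max H and -L₁ ≤ ∫ -min F (`average_limit_le`). -/

noncomputable section

namespace JumpingFloer

/-! ### Calculus of circle averages on a half-cylinder -/

section HalfCylinder

/-- The derivative of the circle average is the circle average of the derivative, in integrated
form. -/
theorem integral_integral_partial {S : Set ℝ} (hS : S.OrdConnected) {h d : ℝ × ℝ → ℝ}
    (hd : ContinuousOn d (S ×ˢ univ)) (hh : ContinuousOn h (S ×ˢ univ))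
    (hder : ∀ τ ∈ S, ∀ t, HasDerivAt (fun s => h (s, t)) (d (τ, t)) τ)
    {a b : ℝ} (ha : a ∈ S) (hb : b ∈ S) :
    ∫ τ in a..b, ∫ t in (0 : ℝ)..1, d (τ, t) =
      (∫ t in (0 : ℝ)..1, h (b, t)) - ∫ t in (0 : ℝ)..1, h (a, t) := by
  have hab : uIcc a b ⊆ S := hS.uIcc_subset ha hb
  have hslice : ∀ τ ∈ S, Continuous fun t => h (τ, t) := fun τ hτ =>
    hh.comp_continuous (by fun_prop) fun t => ⟨hτ, mem_univ t⟩
  have hint : IntegrableOn d (uIoc a b ×ˢ Ioc 0 1) (volume.prod volume) := by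
    have : IntegrableOn d (uIcc a b ×ˢ Icc 0 1) (volume.prod volume) :=
      ContinuousOn.integrableOn_compact (isCompact_uIcc.prod isCompact_Icc)
        (hd.mono (prod_mono hab (subset_univ _)))
    exact this.mono_set (prod_mono uIoc_subset_uIcc Ioc_subset_Icc_self)
  have hswap : ∫ τ in a..b, ∫ t in Ioc (0 : ℝ) 1, d (τ, t) =
      ∫ t in Ioc (0 : ℝ) 1, ∫ τ in a..b, d (τ, t) :=
    intervalIntegral_integral_swap (f := fun τ t => d (τ, t))
      (by rw [Measure.prod_restrict]; exact hint)
  simp only [intervalIntegral.integral_of_le (zero_le_one' ℝ)] at hswap ⊢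
  rw [hswap, ← integral_sub]
  · refine integral_congr_ae (Eventually.of_forall fun t => ?_)
    refine intervalIntegral.integral_eq_sub_of_hasDerivAt (fun τ hτ => hder τ (hab hτ) t) ?_
    exact ContinuousOn.intervalIntegrable (hd.comp (by fun_prop) fun τ hτ => ⟨hab hτ, mem_univ t⟩)
  · exact (hslice b hb).integrableOn_Ioc
  · exact (hslice a ha).integrableOn_Ioc

/-- This is the integrated form of area = energy - dh(∂τ u). The density `e` is only known to be
integrable, so Fubini makes its slices integrable for almost every τ, which is enough to split the
inner integral. -/
theorem integral_integral_sub_partial {S : Set ℝ} (hS : S.OrdConnected) {h d e : ℝ × ℝ → ℝ}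
    (hd : ContinuousOn d (S ×ˢ univ)) (hh : ContinuousOn h (S ×ˢ univ))
    (hder : ∀ τ ∈ S, ∀ t, HasDerivAt (fun s => h (s, t)) (d (τ, t)) τ)
    (he : IntegrableOn e (univ ×ˢ Ioc 0 1))
    {a b : ℝ} (ha : a ∈ S) (hb : b ∈ S) :
    ∫ τ in a..b, ∫ t in (0 : ℝ)..1, (e (τ, t) - d (τ, t)) =
      (∫ τ in a..b, ∫ t in Ioc (0 : ℝ) 1, e (τ, t)) -
        ((∫ t in (0 : ℝ)..1, h (b, t)) - ∫ t in (0 : ℝ)..1, h (a, t)) := by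
  have hab : uIcc a b ⊆ S := hS.uIcc_subset ha hb
  rw [IntegrableOn, Measure.volume_eq_prod, ← Measure.prod_restrict, Measure.restrict_univ] at he
  rw [← integral_integral_partial hS hd hh hder ha hb, ← intervalIntegral.integral_sub]
  · refine intervalIntegral.integral_congr_ae ?_
    filter_upwards [he.prod_right_ae] with τ hτ hmem
    simp only [intervalIntegral.integral_of_le (zero_le_one' ℝ)]
    refine integral_sub hτ ?_
    exact (hd.comp_continuous (by fun_prop)
      fun t => ⟨hab (uIoc_subset_uIcc hmem), mem_univ t⟩ : Continuous fun t => d (τ, t)).integrableOn_Ioc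
  · exact he.integral_prod_left.intervalIntegrable
  · have hint : IntegrableOn d (uIoc a b ×ˢ Ioc 0 1) (volume.prod volume) := by
      have : IntegrableOn d (uIcc a b ×ˢ Icc 0 1) (volume.prod volume) :=
        ContinuousOn.integrableOn_compact (isCompact_uIcc.prod isCompact_Icc)
          (hd.mono (prod_mono hab (subset_univ _)))
      exact this.mono_set (prod_mono uIoc_subset_uIcc Ioc_subset_Icc_self)
    rw [IntegrableOn, ← Measure.prod_restrict] at hint
    simp only [intervalIntegral.integral_of_le (zero_le_one' ℝ)]
    exact intervalIntegrable_iff.2 hint.integral_prod_left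

/-- If `|∂h/∂τ| ≤ K + e` with `e` integrable, then the circle averages of `h` converge as
`τ → 0`. -/
theorem exists_tendsto_average {S : Set ℝ} (hS : S.OrdConnected) (hSo : IsOpen S)
    {h d e : ℝ × ℝ → ℝ}
    (hd : ContinuousOn d (S ×ˢ univ)) (hh : ContinuousOn h (S ×ˢ univ))
    (hder : ∀ τ ∈ S, ∀ t, HasDerivAt (fun s => h (s, t)) (d (τ, t)) τ)
    (he : IntegrableOn e (univ ×ˢ Ioc 0 1)) {K : ℝ}
    (hK : ∀ τ ∈ S, ∀ t ∈ Ioc (0 : ℝ) 1, |d (τ, t)| ≤ K + e (τ, t))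
    {c : ℝ} (hc : c ∈ S) (hcS : uIcc c 0 ⊆ insert 0 S) :
    ∃ L, Tendsto (fun τ => ∫ t in (0 : ℝ)..1, h (τ, t)) (𝓝[uIcc c 0 ∩ S] 0) (𝓝 L) := by
  -- The strip has finite measure, so the constant `K` is integrable on it and `K + e` dominates `d`
  -- up to the jump.
  have hint : IntegrableOn d ((uIoc c 0 ∩ S) ×ˢ Ioc 0 1) := by
    have hKi : IntegrableOn (fun _ : ℝ × ℝ => K) ((uIoc c 0 ∩ S) ×ˢ Ioc 0 1) := by
      refine integrableOn_const (ne_top_of_le_ne_top ?_ (measure_mono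
        (prod_mono (inter_subset_left.trans uIoc_subset_uIcc) Ioc_subset_Icc_self)))
      exact (isCompact_uIcc.prod isCompact_Icc).measure_lt_top.ne
    refine Integrable.mono' (hKi.add (he.mono_set (prod_mono (subset_univ _) subset_rfl)))
      ?_ ?_
    · exact ((hd.mono (prod_mono inter_subset_right (subset_univ _))).aestronglyMeasurable
        ((measurableSet_uIoc.inter hSo.measurableSet).prod measurableSet_Ioc))
    · refine (ae_restrict_iff' ((measurableSet_uIoc.inter hSo.measurableSet).prod
        measurableSet_Ioc)).2 (Eventually.of_forall fun p hp => ?_)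
      exact hK p.1 hp.1.2 p.2 hp.2
  rw [IntegrableOn, Measure.volume_eq_prod, ← Measure.prod_restrict] at hint
  -- Removing the points outside `S` costs at most the null set {0}.
  have hDi : IntervalIntegrable (fun τ => ∫ t in Ioc (0 : ℝ) 1, d (τ, t)) volume c 0 := by
    refine intervalIntegrable_iff.2 (IntegrableOn.congr_set_ae hint.integral_prod_left ?_)
    have h0 : ∀ᵐ τ : ℝ, τ ≠ 0 := by simp [ae_iff]
    filter_upwards [h0] with τ hτ
    refine propext ⟨fun hm => ⟨hm, ?_⟩, fun hm => hm.1⟩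
    exact (hcS (uIoc_subset_uIcc hm)).resolve_left hτ
  have hcont := intervalIntegral.continuousOn_primitive_interval' hDi left_mem_uIcc 0 right_mem_uIcc
  -- The limit is the value at 0 of the continuous primitive which agrees with the averages inside
  -- `S`.
  refine ⟨(∫ t in (0 : ℝ)..1, h (c, t)) + ∫ τ in c..0, ∫ t in Ioc (0 : ℝ) 1, d (τ, t), ?_⟩
  have := (hcont.tendsto.mono_left (nhdsWithin_mono 0
    (inter_subset_left : uIcc c 0 ∩ S ⊆ _))).const_add (∫ t in (0 : ℝ)..1, h (c, t))
  refine this.congr' ?_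
  filter_upwards [self_mem_nhdsWithin] with τ hτ
  have := integral_integral_partial hS hd hh hder hc hτ.2
  simp only [intervalIntegral.integral_of_le (zero_le_one' ℝ)] at this ⊢
  rw [this]; ring

/-- Integrability of `E` handles both ends of the energy term, and `G` contributes only its boundary
limits. The product filter lets the two ends move independently. -/
theorem tendsto_integral_negative {E G : ℝ → ℝ} {a b : ℝ} (hE : Integrable E)
    {Φ : ℝ → ℝ → ℝ} (hΦ : ∀ x < 0, ∀ y < 0, Φ x y = (∫ τ in x..y, E τ) - (G y - G x))
    (ha : Tendsto G atBot (𝓝 a)) (hb : Tendsto G (𝓝[<] 0) (𝓝 b)) :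
    Tendsto (fun q : ℝ × ℝ => Φ q.1 q.2) (atBot ×ˢ 𝓝[<] 0)
      (𝓝 ((∫ τ in Iio 0, E τ) - (b - a))) := by
  have h1 : Tendsto (fun q : ℝ × ℝ => ∫ τ in q.1..q.2, E τ) (atBot ×ˢ 𝓝[<] 0)
      (𝓝 (∫ τ in Iio 0, E τ)) := by
    have hl : Tendsto (fun q : ℝ × ℝ => ∫ τ in q.1..0, E τ) (atBot ×ˢ 𝓝[<] (0 : ℝ))
        (𝓝 (∫ τ in Iic 0, E τ)) :=
      intervalIntegral_tendsto_integral_Iic 0 hE.integrableOn tendsto_fst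
    have hr : Tendsto (fun q : ℝ × ℝ => ∫ τ in (0 : ℝ)..q.2, E τ)
        (atBot ×ˢ 𝓝[<] (0 : ℝ)) (𝓝 0) := by
      have := (intervalIntegral.continuous_primitive (fun x y => hE.intervalIntegrable) 0).tendsto
        (0 : ℝ) (f := fun y => ∫ τ in (0 : ℝ)..y, E τ)
      rw [intervalIntegral.integral_same] at this
      exact (this.mono_left nhdsWithin_le_nhds).comp tendsto_snd
    rw [← integral_Iic_eq_integral_Iio]
    simpa [intervalIntegral.integral_add_adjacent_intervals hE.intervalIntegrable
      hE.intervalIntegrable] using hl.add hr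
  refine (h1.sub ((hb.comp tendsto_snd).sub (ha.comp tendsto_fst))).congr' ?_
  have hx : ∀ᶠ q : ℝ × ℝ in atBot ×ˢ 𝓝[<] (0 : ℝ), q.1 < 0 :=
    tendsto_fst.eventually (eventually_lt_atBot 0)
  have hy : ∀ᶠ q : ℝ × ℝ in atBot ×ˢ 𝓝[<] (0 : ℝ), q.2 < 0 :=
    tendsto_snd.eventually (self_mem_nhdsWithin (s := Iio (0 : ℝ)))
  filter_upwards [hx, hy] with q h1 h2
  exact (hΦ _ h1 _ h2).symm

theorem tendsto_integral_positive {E G : ℝ → ℝ} {a b : ℝ} (hE : Integrable E)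
    {Φ : ℝ → ℝ → ℝ} (hΦ : ∀ x > 0, ∀ y > 0, Φ x y = (∫ τ in x..y, E τ) - (G y - G x))
    (ha : Tendsto G (𝓝[>] 0) (𝓝 a)) (hb : Tendsto G atTop (𝓝 b)) :
    Tendsto (fun q : ℝ × ℝ => Φ q.1 q.2) (𝓝[>] 0 ×ˢ atTop)
      (𝓝 ((∫ τ in Ioi 0, E τ) - (b - a))) := by
  have h1 : Tendsto (fun q : ℝ × ℝ => ∫ τ in q.1..q.2, E τ) (𝓝[>] 0 ×ˢ atTop)
      (𝓝 (∫ τ in Ioi 0, E τ)) := by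
    have hr : Tendsto (fun q : ℝ × ℝ => ∫ τ in (0 : ℝ)..q.2, E τ) (𝓝[>] (0 : ℝ) ×ˢ atTop)
        (𝓝 (∫ τ in Ioi 0, E τ)) :=
      intervalIntegral_tendsto_integral_Ioi 0 hE.integrableOn tendsto_snd
    have hl : Tendsto (fun q : ℝ × ℝ => ∫ τ in (0 : ℝ)..q.1, E τ)
        (𝓝[>] (0 : ℝ) ×ˢ atTop) (𝓝 0) := by
      have := (intervalIntegral.continuous_primitive (fun x y => hE.intervalIntegrable) 0).tendsto
        (0 : ℝ) (f := fun y => ∫ τ in (0 : ℝ)..y, E τ)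
      rw [intervalIntegral.integral_same] at this
      exact (this.mono_left nhdsWithin_le_nhds).comp tendsto_fst
    simpa [intervalIntegral.integral_interval_sub_left hE.intervalIntegrable
      hE.intervalIntegrable] using hr.sub hl
  refine (h1.sub ((hb.comp tendsto_snd).sub (ha.comp tendsto_fst))).congr' ?_
  have hx : ∀ᶠ q : ℝ × ℝ in 𝓝[>] (0 : ℝ) ×ˢ atTop, 0 < q.1 :=
    tendsto_fst.eventually (self_mem_nhdsWithin (s := Ioi (0 : ℝ)))
  have hy : ∀ᶠ q : ℝ × ℝ in 𝓝[>] (0 : ℝ) ×ˢ atTop, 0 < q.2 :=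
    tendsto_snd.eventually (eventually_gt_atTop 0)
  filter_upwards [hx, hy] with q h1 h2
  exact (hΦ _ h1 _ h2).symm

end HalfCylinder

/-! ### The differential as a real-valued functional -/

section Differential

variable {E : Type*} [NormedAddCommGroup E] [NormedSpace ℝ E]
  {M : Type*} [TopologicalSpace M] [ChartedSpace E M]

/-- The value `dh(v)` of the differential of `h : M → ℝ`, as a real number. -/
def differential (h : M → ℝ) (x : M) (v : TangentSpace 𝓘(ℝ, E) x) : ℝ :=
  (mfderiv 𝓘(ℝ, E) 𝓘(ℝ, ℝ) h x : E →L[ℝ] ℝ) v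

theorem differential_smul (h : M → ℝ) (x : M) (r : ℝ) (v : TangentSpace 𝓘(ℝ, E) x) :
    differential h x (r • v) = r * differential h x v :=
  (mfderiv 𝓘(ℝ, E) 𝓘(ℝ, ℝ) h x : E →L[ℝ] ℝ).map_smul r v

end Differential

/-! ### Linear algebra of compatible structures and the Floer equation -/

section Linear

variable {E : Type*} [NormedAddCommGroup E] [NormedSpace ℝ E]
  {M : Type*} [TopologicalSpace M] [ChartedSpace E M]

theorem alternating_add_right (f : E [⋀^Fin 2]→L[ℝ] ℝ) (a b c : E) :
    f ![a, b + c] = f ![a, b] + f ![a, c] := by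
  have h1 : ∀ a b c : E, Function.update ![a, b] 1 c = ![a, c] := fun a b c => by
    ext i; fin_cases i <;> rfl
  simpa only [h1] using f.map_update_add ![a, b] 1 b c

theorem alternating_smul_right (f : E [⋀^Fin 2]→L[ℝ] ℝ) (r : ℝ) (a b : E) :
    f ![a, r • b] = r * f ![a, b] := by
  have h1 : ∀ a b c : E, Function.update ![a, b] 1 c = ![a, c] := fun a b c => by
    ext i; fin_cases i <;> rfl
  simpa only [h1, smul_eq_mul] using f.map_update_smul ![a, b] 1 r b

theorem alternating_swap (f : E [⋀^Fin 2]→L[ℝ] ℝ) (a b : E) : f ![a, b] = -f ![b, a] := by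
  have h : ![b, a] ∘ Equiv.swap (0 : Fin 2) 1 = ![a, b] := by
    ext i; fin_cases i <;> rfl
  rw [← h]
  exact f.toAlternatingMap.map_swap ![b, a] (i := 0) (j := 1) (by decide)

theorem normSq_smul (Ω : SymplecticForm E M) {x : M}
    (J : TangentSpace 𝓘(ℝ, E) x →L[ℝ] TangentSpace 𝓘(ℝ, E) x) (r : ℝ)
    (v : TangentSpace 𝓘(ℝ, E) x) : normSq Ω J (r • v) = r ^ 2 * normSq Ω J v := by
  have key : ∀ (f : E [⋀^Fin 2]→L[ℝ] ℝ) (a b : E), f ![r • a, r • b] = r ^ 2 * f ![a, b] := by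
    intro f a b
    rw [alternating_smul_right, alternating_swap, alternating_smul_right, alternating_swap f b]
    ring
  unfold normSq
  rw [map_smul]
  exact key (Ω.form x) v (J v)

variable [IsManifold 𝓘(ℝ, E) ∞ M] {Ω : SymplecticForm E M}
  {J : ℝ → ∀ x : M, TangentSpace 𝓘(ℝ, E) x →L[ℝ] TangentSpace 𝓘(ℝ, E) x}

theorem IsCompatibleFamily.normSq_nonneg (hJ : IsCompatibleFamily Ω J) (t : ℝ) (x : M)
    (v : TangentSpace 𝓘(ℝ, E) x) : 0 ≤ normSq Ω (J t x) v := by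
  by_cases hv : v = 0
  · have := normSq_smul Ω (J t x) 0 v
    rw [zero_smul, ← hv] at this
    rw [this]; simp
  · exact (hJ.positive t x v hv).le

/-- The Floer equation `v + J(w - X_h) = 0` determines the area density and the energy density. -/
theorem IsCompatibleFamily.floer_identities [FiniteDimensional ℝ E] (hJ : IsCompatibleFamily Ω J)
    (t : ℝ) (x : M) (h : M → ℝ) (v w : TangentSpace 𝓘(ℝ, E) x)
    (hvw : v + J t x (w - hamiltonianVectorField Ω h x) = 0) :
    Ω.form x ![v, w] = normSq Ω (J t x) v - differential h x v ∧
      normSq Ω (J t x) (w - hamiltonianVectorField Ω h x) = normSq Ω (J t x) v := by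
  -- Apply J to the equation and use J² = -1.
  have hJv : w - hamiltonianVectorField Ω h x = J t x v := by
    have := congrArg (J t x) hvw
    rw [map_add, map_zero, hJ.sq_eq_neg, ← sub_eq_add_neg, sub_eq_zero] at this
    exact this.symm
  constructor
  -- ω(v, w) splits into ω(v, Jv) = |v|² and ω(v, X_h) = -ω(X_h, v) = -dh(v).
  · have hw : w = J t x v + hamiltonianVectorField Ω h x := by rw [← hJv, sub_add_cancel]
    have h1 := alternating_add_right (E := E) (Ω.form x) v (J t x v) (hamiltonianVectorField Ω h x)
    have h2 := alternating_swap (E := E) (Ω.form x) v (hamiltonianVectorField Ω h x)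
    have h3 := form_hamiltonianVectorField Ω h x v
    rw [hw]
    refine h1.trans ?_
    rw [h2, sub_eq_add_neg]
    exact congrArg (fun r => normSq Ω (J t x) v + -r) h3
  · rw [hJv]
    exact hJ.invariant t x v (J t x v)

end Linear

/-! ### Uniform bound of dH by the compatible metrics -/

section Bound

variable {E : Type*} [NormedAddCommGroup E] [NormedSpace ℝ E]
  {M : Type*} [TopologicalSpace M] [ChartedSpace E M] [IsManifold 𝓘(ℝ, E) ∞ M]

/-- The tangent vector at `φ⁻¹(y)` with coordinates `v` in the chart `φ` at `x₀`. -/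
theorem mfderiv_extChartAt_symm_eq_symmL (x₀ : M) {y : E}
    (hy : y ∈ (extChartAt 𝓘(ℝ, E) x₀).target) :
    (mfderiv 𝓘(ℝ, E) 𝓘(ℝ, E) (extChartAt 𝓘(ℝ, E) x₀).symm y : E →L[ℝ] E) =
      (trivializationAt E (TangentSpace 𝓘(ℝ, E)) x₀).symmL ℝ
        ((extChartAt 𝓘(ℝ, E) x₀).symm y) := by
  have : IsManifold 𝓘(ℝ, E) 1 M := .of_le (n := ∞) (by norm_num)
  have hx : (extChartAt 𝓘(ℝ, E) x₀).symm y ∈ (chartAt E x₀).source := by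
    rw [← extChartAt_source 𝓘(ℝ, E)]; exact (extChartAt 𝓘(ℝ, E) x₀).map_target hy
  have h := TangentBundle.symmL_trivializationAt (I := 𝓘(ℝ, E)) hx
  -- The base point is generalized because `h` is stated at φ(φ⁻¹(y)), which equals `y` only
  -- propositionally.
  have h2 : ∀ y' : E, y' = y →
      (mfderivWithin 𝓘(ℝ, E) 𝓘(ℝ, E) (extChartAt 𝓘(ℝ, E) x₀).symm (range 𝓘(ℝ, E)) y' : E →L[ℝ] E)
        = (mfderiv 𝓘(ℝ, E) 𝓘(ℝ, E) (extChartAt 𝓘(ℝ, E) x₀).symm y : E →L[ℝ] E) := by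
    rintro _ rfl
    rw [modelWithCornersSelf_coe, range_id, mfderivWithin_univ]
  exact ((h.trans (h2 _ ((extChartAt 𝓘(ℝ, E) x₀).right_inv hy)))).symm

/-- In the tangent trivialization, J becomes a map of coordinate vectors, continuous because the
bundle map is smooth on [0, 1]. The norm is then the evaluation of the smooth form `chartForm` on
the pair (v, Jv) in coordinates. -/
theorem continuousOn_normSq_chart {Ω : SymplecticForm E M}
    {J : ℝ → ∀ x : M, TangentSpace 𝓘(ℝ, E) x →L[ℝ] TangentSpace 𝓘(ℝ, E) x}
    (hJ : IsCompatibleFamily Ω J) (x₀ : M) :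
    ContinuousOn (fun p : (ℝ × E) × E => normSq Ω (J p.1.1 ((extChartAt 𝓘(ℝ, E) x₀).symm p.1.2))
      (mfderiv 𝓘(ℝ, E) 𝓘(ℝ, E) (extChartAt 𝓘(ℝ, E) x₀).symm p.1.2 p.2))
      ((Icc 0 1 ×ˢ (extChartAt 𝓘(ℝ, E) x₀).target) ×ˢ univ) := by
  set φ := extChartAt 𝓘(ℝ, E) x₀ with hφ
  set e := trivializationAt E (TangentSpace 𝓘(ℝ, E)) x₀ with he
  set S : Set ((ℝ × E) × E) := (Icc 0 1 ×ˢ φ.target) ×ˢ univ with hS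
  have hbase : ∀ y ∈ φ.target, φ.symm y ∈ e.baseSet := fun y hy => by
    have := φ.map_target hy
    rwa [hφ, extChartAt_source] at this
  have hsymm : ContinuousOn (fun p : (ℝ × E) × E => φ.symm p.1.2) S :=
    (continuousOn_extChartAt_symm x₀).comp (by fun_prop) fun p hp => hp.1.2
  have h1 : ContinuousOn (fun p : (ℝ × E) × E => (p.1.1,
      (⟨φ.symm p.1.2, e.symm (φ.symm p.1.2) p.2⟩ : TangentBundle 𝓘(ℝ, E) M))) S := by
    refine ContinuousOn.prodMk (by fun_prop) ?_
    exact e.continuousOn_symm.comp (hsymm.prodMk continuousOn_snd)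
      fun p hp => ⟨hbase _ hp.1.2, mem_univ _⟩
  have h2 := hJ.smooth.continuousOn.comp h1 (fun p hp => ⟨hp.1.1, mem_univ _⟩)
  have h3 := e.continuousOn.comp h2 fun p hp => by
    rw [e.mem_source]; exact hbase _ hp.1.2
  have hA : ContinuousOn (fun p : (ℝ × E) × E =>
      e.continuousLinearMapAt ℝ (φ.symm p.1.2)
        (J p.1.1 (φ.symm p.1.2) (e.symmL ℝ (φ.symm p.1.2) p.2))) S := by
    refine (continuous_snd.comp_continuousOn h3).congr fun p hp => ?_
    rw [e.continuousLinearMapAt_apply_of_mem (R := ℝ) (hbase _ hp.1.2),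
      e.symmL_apply (R := ℝ) (hbase _ hp.1.2)]
    rfl
  have hform : ContinuousOn (fun p : (ℝ × E) × E => chartForm Ω.form x₀ p.1.2) S :=
    (Ω.smooth x₀).continuousOn.comp (by fun_prop) fun p hp => hp.1.2
  have hvec : ContinuousOn (fun p : (ℝ × E) × E => ![p.2, e.continuousLinearMapAt ℝ (φ.symm p.1.2)
        (J p.1.1 (φ.symm p.1.2) (e.symmL ℝ (φ.symm p.1.2) p.2))]) S := by
    refine continuousOn_pi.2 fun i => ?_
    fin_cases i
    · exact continuousOn_snd
    · exact hA
  have heval : Continuous fun q : (E [⋀^Fin 2]→L[ℝ] ℝ) × (Fin 2 → E) => q.1 q.2 := continuous_eval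
  refine (heval.comp_continuousOn (hform.prodMk hvec)).congr fun p hp => ?_
  have hD := mfderiv_extChartAt_symm_eq_symmL x₀ hp.1.2
  have hvec2 : ∀ a b : E, (fun i => (mfderiv 𝓘(ℝ, E) 𝓘(ℝ, E) φ.symm p.1.2 : E →L[ℝ] E)
      (![a, b] i)) = ![e.symmL ℝ (φ.symm p.1.2) a, e.symmL ℝ (φ.symm p.1.2) b] := by
    intro a b
    rw [hD]
    ext i; fin_cases i <;> rfl
  have := hvec2 p.2 (e.continuousLinearMapAt ℝ (φ.symm p.1.2)
        (J p.1.1 (φ.symm p.1.2) (e.symmL ℝ (φ.symm p.1.2) p.2)))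
  rw [e.symmL_continuousLinearMapAt (hbase _ hp.1.2)] at this
  refine Eq.trans ?_ (congrArg (Ω.form (φ.symm p.1.2)) this).symm
  have h5 := congrArg (fun L : E →L[ℝ] E => normSq Ω (J p.1.1 (φ.symm p.1.2)) (L p.2)) hD
  exact h5

/-- By the chain rule this is the full derivative of (t, y) ↦ H(t, φ⁻¹(y)) applied to (0, v), and
that function is smooth. -/
theorem continuousOn_differential_chart {H : ℝ → M → ℝ} (hH : IsPeriodicHamiltonian E H) (x₀ : M) :
    ContinuousOn (fun p : (ℝ × E) × E => differential (H p.1.1)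
      ((extChartAt 𝓘(ℝ, E) x₀).symm p.1.2)
      (mfderiv 𝓘(ℝ, E) 𝓘(ℝ, E) (extChartAt 𝓘(ℝ, E) x₀).symm p.1.2 p.2))
      ((univ ×ˢ (extChartAt 𝓘(ℝ, E) x₀).target) ×ˢ univ) := by
  set φ := extChartAt 𝓘(ℝ, E) x₀ with hφ
  have hT : IsOpen φ.target := isOpen_extChartAt_target x₀
  have hopen : IsOpen ((univ : Set ℝ) ×ˢ φ.target) := isOpen_univ.prod hT
  have hsymm : ContMDiffOn 𝓘(ℝ, E) 𝓘(ℝ, E) ∞ φ.symm φ.target := contMDiffOn_extChartAt_symm x₀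
  have hg : ContDiffOn ℝ ∞ (fun p : ℝ × E => H p.1 (φ.symm p.2)) (univ ×ˢ φ.target) := by
    rw [← contMDiffOn_iff_contDiffOn]
    refine hH.smooth.comp_contMDiffOn (ContMDiffOn.prodMk ?_ ?_)
    · exact contDiff_fst.contMDiff.contMDiffOn
    · exact hsymm.comp contDiff_snd.contMDiff.contMDiffOn fun p hp => hp.2
  have hf : ContinuousOn (fun p : (ℝ × E) × E =>
      fderiv ℝ (fun p : ℝ × E => H p.1 (φ.symm p.2)) p.1 (0, p.2))
      ((univ ×ˢ φ.target) ×ˢ univ) :=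
    ((hg.continuousOn_fderiv_of_isOpen hopen (by norm_num)).comp continuousOn_fst
      fun p hp => hp.1).clm_apply (by fun_prop)
  refine hf.congr fun p hp => ?_
  obtain ⟨⟨t, y⟩, v⟩ := p
  have hy : y ∈ φ.target := hp.1.2
  have hHt : MDifferentiableAt 𝓘(ℝ, E) 𝓘(ℝ, ℝ) (H t) (φ.symm y) :=
    ((hH.smooth.comp (contMDiff_const.prodMk contMDiff_id) :
      ContMDiff 𝓘(ℝ, E) 𝓘(ℝ, ℝ) ∞ (H t)).mdifferentiableAt (by norm_num))
  have hsy : MDifferentiableAt 𝓘(ℝ, E) 𝓘(ℝ, E) φ.symm y :=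
    (hsymm.contMDiffAt (hT.mem_nhds hy)).mdifferentiableAt (by norm_num)
  have h1 := mfderiv_comp_apply y hHt hsy v
  rw [mfderiv_eq_fderiv] at h1
  refine h1.symm.trans ?_
  have hgd : HasFDerivAt (fun p : ℝ × E => H p.1 (φ.symm p.2)) _ (t, y) :=
    ((hg.contDiffAt (hopen.mem_nhds ⟨mem_univ t, hy⟩)).differentiableAt (by norm_num)).hasFDerivAt
  have h2 := hgd.comp y (hasFDerivAt_prodMk_right t y)
  have h3 := congrArg (fun L : E →L[ℝ] ℝ => L v) h2.fderiv
  refine h3.trans ?_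
  simp

/-- On a compact manifold the differential of a Hamiltonian is uniformly bounded with respect to
the metrics of a compatible family. -/
theorem exists_differential_sq_le [FiniteDimensional ℝ E] [CompactSpace M] {Ω : SymplecticForm E M}
    {J : ℝ → ∀ x : M, TangentSpace 𝓘(ℝ, E) x →L[ℝ] TangentSpace 𝓘(ℝ, E) x}
    (hJ : IsCompatibleFamily Ω J) {H : ℝ → M → ℝ} (hH : IsPeriodicHamiltonian E H) :
    ∃ K : ℝ, ∀ t ∈ Icc (0 : ℝ) 1, ∀ (x : M) (v : TangentSpace 𝓘(ℝ, E) x),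
      differential (H t) x v ^ 2 ≤ K * normSq Ω (J t x) v := by
  have hmono : ∀ {K K' : ℝ}, K ≤ K' → ∀ {t : ℝ} {x : M} {v : TangentSpace 𝓘(ℝ, E) x},
      differential (H t) x v ^ 2 ≤ K * normSq Ω (J t x) v →
      differential (H t) x v ^ 2 ≤ K' * normSq Ω (J t x) v := fun hK _ _ _ h =>
    h.trans (mul_le_mul_of_nonneg_right hK (hJ.normSq_nonneg _ _ _))
  -- Both sides are quadratic in v, so near (t₀, x₀) it suffices to treat the compact unit sphere of
  -- chart vectors.
  have hlocal : ∀ t₀ ∈ Icc (0 : ℝ) 1, ∀ x₀ : M, ∃ K : ℝ, ∀ᶠ q : ℝ × M in 𝓝 (t₀, x₀),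
      q.1 ∈ Icc (0 : ℝ) 1 → ∀ v : TangentSpace 𝓘(ℝ, E) q.2,
        differential (H q.1) q.2 v ^ 2 ≤ K * normSq Ω (J q.1 q.2) v := by
    intro t₀ ht₀ x₀
    have : IsManifold 𝓘(ℝ, E) 1 M := .of_le (n := ∞) (by norm_num)
    set φ := extChartAt 𝓘(ℝ, E) x₀ with hφ
    set D : ∀ y : E, TangentSpace 𝓘(ℝ, E) y →L[ℝ] TangentSpace 𝓘(ℝ, E) (φ.symm y) :=
      fun y => mfderiv 𝓘(ℝ, E) 𝓘(ℝ, E) φ.symm y with hDdef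
    have hbase : ∀ y ∈ φ.target,
        φ.symm y ∈ (trivializationAt E (TangentSpace 𝓘(ℝ, E)) x₀).baseSet := fun y hy => by
      have := φ.map_target hy
      rwa [hφ, extChartAt_source] at this
    have hDinj : ∀ y ∈ φ.target, ∀ v : E, v ≠ 0 → D y v ≠ 0 := by
      intro y hy v hv h0
      have hD := congrArg (fun L : E →L[ℝ] E => L v) (mfderiv_extChartAt_symm_eq_symmL x₀ hy)
      have h1 : (trivializationAt E (TangentSpace 𝓘(ℝ, E)) x₀).symmL ℝ (φ.symm y) v = 0 :=
        hD.symm.trans h0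
      have h2 := (trivializationAt E (TangentSpace 𝓘(ℝ, E)) x₀).continuousLinearMapAt_symmL
        (R := ℝ) (hbase y hy) v
      rw [h1, map_zero] at h2
      exact hv h2.symm
    have hDsurj : ∀ y ∈ φ.target, ∀ w : TangentSpace 𝓘(ℝ, E) (φ.symm y), ∃ v : E, D y v = w := by
      intro y hy w
      refine ⟨(trivializationAt E (TangentSpace 𝓘(ℝ, E)) x₀).continuousLinearMapAt ℝ (φ.symm y) w,
        ?_⟩
      have hD := congrArg (fun L : E →L[ℝ] E => L
        ((trivializationAt E (TangentSpace 𝓘(ℝ, E)) x₀).continuousLinearMapAt ℝ (φ.symm y) w))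
        (mfderiv_extChartAt_symm_eq_symmL x₀ hy)
      exact hD.trans ((trivializationAt E (TangentSpace 𝓘(ℝ, E)) x₀).symmL_continuousLinearMapAt
        (R := ℝ) (hbase y hy) w)
    have hy₀ : φ x₀ ∈ φ.target := mem_extChartAt_target x₀
    have hsphere : ∃ K : ℝ, ∀ᶠ z : ℝ × E in 𝓝[Icc 0 1 ×ˢ φ.target] (t₀, φ x₀),
        ∀ v ∈ Metric.sphere (0 : E) 1, differential (H z.1) (φ.symm z.2) (D z.2 v) ^ 2 ≤
          K * normSq Ω (J z.1 (φ.symm z.2)) (D z.2 v) := by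
      refine (isCompact_sphere (0 : E) 1).induction_on (p := fun s => ∃ K : ℝ,
        ∀ᶠ z : ℝ × E in 𝓝[Icc 0 1 ×ˢ φ.target] (t₀, φ x₀),
        ∀ v ∈ s, differential (H z.1) (φ.symm z.2) (D z.2 v) ^ 2 ≤
          K * normSq Ω (J z.1 (φ.symm z.2)) (D z.2 v)) ⟨0, by simp⟩ ?_ ?_ ?_
      · rintro s s' hss ⟨K, hK⟩
        exact ⟨K, hK.mono fun z hz v hv => hz v (hss hv)⟩
      · rintro s s' ⟨K, hK⟩ ⟨K', hK'⟩
        refine ⟨max K K', ?_⟩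
        filter_upwards [hK, hK'] with z hz hz' v hv
        exact hv.elim (fun h => hmono (le_max_left _ _) (hz v h))
          fun h => hmono (le_max_right _ _) (hz' v h)
      · intro v₀ hv₀
        have hv0 : v₀ ≠ 0 := by
          rintro rfl; simp at hv₀
        have hg := continuousOn_normSq_chart hJ x₀ ((t₀, φ x₀), v₀) ⟨⟨ht₀, hy₀⟩, mem_univ _⟩
        have hd := (continuousOn_differential_chart hH x₀ ((t₀, φ x₀), v₀)
          ⟨⟨mem_univ _, hy₀⟩, mem_univ _⟩).mono
          (prod_mono (prod_mono (subset_univ (Icc (0 : ℝ) 1)) subset_rfl) subset_rfl)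
        have hpos := hJ.positive t₀ (φ.symm (φ x₀)) (D (φ x₀) v₀) (hDinj _ hy₀ v₀ hv0)
        have hpos' : 0 < normSq Ω (J t₀ (φ.symm (φ x₀))) (D (φ x₀) v₀) := hpos
        obtain ⟨K, hK⟩ : ∃ K : ℝ, differential (H t₀) (φ.symm (φ x₀)) (D (φ x₀) v₀) ^ 2 <
            K * normSq Ω (J t₀ (φ.symm (φ x₀))) (D (φ x₀) v₀) :=
          -- The `+ 1` makes the inequality strict, so that it persists at nearby (t, y, v).
          ⟨(differential (H t₀) (φ.symm (φ x₀)) (D (φ x₀) v₀) ^ 2 + 1) /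
            normSq Ω (J t₀ (φ.symm (φ x₀))) (D (φ x₀) v₀), by
            rw [div_mul_cancel₀ _ hpos'.ne']; linarith⟩
        have hev := Tendsto.eventually_lt (hd.pow 2) (hg.const_mul K) hK
        -- Splitting into a product neighbourhood makes the set of base points uniform over nearby
        -- v, as the covering argument on the sphere requires.
        rw [nhdsWithin_prod_eq, nhdsWithin_univ] at hev
        obtain ⟨pz, hpz, pv, hpv, hp⟩ := eventually_prod_iff.1 hev
        exact ⟨{v | pv v}, mem_nhdsWithin_of_mem_nhds hpv, K,
          hpz.mono fun z hz v hv => (hp hz hv).le⟩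
    obtain ⟨K, hK⟩ := hsphere
    refine ⟨K, ?_⟩
    have hall : ∀ᶠ z : ℝ × E in 𝓝[Icc 0 1 ×ˢ φ.target] (t₀, φ x₀), z.2 ∈ φ.target ∧
        ∀ w : TangentSpace 𝓘(ℝ, E) (φ.symm z.2), differential (H z.1) (φ.symm z.2) w ^ 2 ≤
          K * normSq Ω (J z.1 (φ.symm z.2)) w := by
      filter_upwards [hK, self_mem_nhdsWithin] with z hz hzT
      refine ⟨hzT.2, fun w => ?_⟩
      obtain ⟨v, rfl⟩ := hDsurj z.2 hzT.2 w
      rcases eq_or_ne v 0 with rfl | hv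
      · have h0 : D z.2 (0 : E) = (0 : ℝ) • D z.2 (0 : E) := by
          rw [zero_smul]; exact map_zero (D z.2)
        rw [h0, differential_smul, normSq_smul]; simp
      · have h1 := hz (‖v‖⁻¹ • v) (by simp [norm_smul, hv])
        have h2 : D z.2 (‖v‖⁻¹ • v) = ‖v‖⁻¹ • D z.2 v := (D z.2).map_smul _ _
        rw [h2, differential_smul, normSq_smul, mul_pow, mul_left_comm] at h1
        exact le_of_mul_le_mul_left h1 (by positivity)
    have hcont : Tendsto (fun q : ℝ × M => (q.1, φ q.2)) (𝓝[Icc 0 1 ×ˢ φ.source] (t₀, x₀))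
        (𝓝[Icc 0 1 ×ˢ φ.target] (t₀, φ x₀)) := by
      refine tendsto_nhdsWithin_iff.2 ⟨?_, ?_⟩
      · have h1 : Tendsto (fun q : ℝ × M => φ q.2) (𝓝 (t₀, x₀)) (𝓝 (φ x₀)) :=
          (continuousAt_extChartAt x₀ : ContinuousAt φ x₀).tendsto.comp
            (continuous_snd.tendsto (t₀, x₀))
        exact (((continuous_fst.tendsto (t₀, x₀)).prodMk_nhds h1)).mono_left nhdsWithin_le_nhds
      · filter_upwards [self_mem_nhdsWithin] with q hq
        exact ⟨hq.1, φ.map_source hq.2⟩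
    have hfin := eventually_nhdsWithin_iff.1 (hcont.eventually hall)
    have hsrc : ∀ᶠ q : ℝ × M in 𝓝 (t₀, x₀), q.2 ∈ φ.source :=
      (continuous_snd.tendsto (t₀, x₀)).eventually (extChartAt_source_mem_nhds x₀)
    filter_upwards [hfin, hsrc] with q hq hqs hqt
    have h := (hq ⟨hqt, hqs⟩).2
    rw [φ.left_inv hqs] at h
    exact h
  -- A finite cover makes the local constants global, the larger constant serving on a union because
  -- |v|² ≥ 0.
  have hcomp : IsCompact ((Icc (0 : ℝ) 1) ×ˢ (univ : Set M)) := isCompact_Icc.prod isCompact_univ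
  obtain ⟨K, hK⟩ := hcomp.induction_on (p := fun s => ∃ K : ℝ, ∀ q ∈ s, q.1 ∈ Icc (0 : ℝ) 1 →
      ∀ v : TangentSpace 𝓘(ℝ, E) q.2,
        differential (H q.1) q.2 v ^ 2 ≤ K * normSq Ω (J q.1 q.2) v) ⟨0, by simp⟩
    (fun s s' hss ⟨K, hK⟩ => ⟨K, fun q hq => hK q (hss hq)⟩)
    (fun s s' ⟨K, hK⟩ ⟨K', hK'⟩ => ⟨max K K', fun q hq ht v => hq.elim
      (fun h => hmono (le_max_left _ _) (hK q h ht v))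
      fun h => hmono (le_max_right _ _) (hK' q h ht v)⟩)
    (fun q hq => by
      obtain ⟨K, hK⟩ := hlocal q.1 hq.1 q.2
      exact ⟨_, mem_nhdsWithin_of_mem_nhds hK, K, fun q' hq' => hq'⟩)
  exact ⟨K, fun t ht x v => hK (t, x) ⟨ht, mem_univ _⟩ ht v⟩

end Bound

/-! ### Hamiltonians along piecewise smooth cylinders -/

section Cylinder

variable {E : Type*} [NormedAddCommGroup E] [NormedSpace ℝ E]
  {M : Type*} [TopologicalSpace M] [ChartedSpace E M]

theorem isOpen_fst_ne_zero : IsOpen {p : ℝ × ℝ | p.1 ≠ 0} :=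
  isOpen_compl_singleton.preimage continuous_fst

variable {H : ℝ → M → ℝ} {u : ℝ × ℝ → M}

theorem IsPiecewiseSmoothCylinder.contDiffOn_hamiltonian (hH : IsPeriodicHamiltonian E H)
    (hu : IsPiecewiseSmoothCylinder E u) :
    ContDiffOn ℝ ∞ (fun p : ℝ × ℝ => H p.2 (u p)) {p | p.1 ≠ 0} := by
  rw [← contMDiffOn_iff_contDiffOn]
  exact hH.smooth.comp_contMDiffOn
    (ContMDiffOn.prodMk contDiff_snd.contMDiff.contMDiffOn hu.smooth)

theorem IsPiecewiseSmoothCylinder.hasDerivAt_hamiltonian (hH : IsPeriodicHamiltonian E H)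
    (hu : IsPiecewiseSmoothCylinder E u) {p : ℝ × ℝ} (hp : p.1 ≠ 0) :
    HasDerivAt (fun s => H p.2 (u (s, p.2))) (differential (H p.2) (u p) (partialTau E u p))
      p.1 := by
  have hline : ContMDiffAt 𝓘(ℝ, ℝ) 𝓘(ℝ, ℝ × ℝ) ∞ (fun s : ℝ => (s, p.2)) p.1 :=
    (contDiff_id.prodMk contDiff_const).contMDiff.contMDiffAt
  have hus : MDifferentiableAt 𝓘(ℝ, ℝ) 𝓘(ℝ, E) (fun s : ℝ => u (s, p.2)) p.1 :=
    ((hu.smooth.contMDiffAt (isOpen_fst_ne_zero.mem_nhds hp)).comp p.1 hline).mdifferentiableAt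
      (by norm_num)
  have hHt : MDifferentiableAt 𝓘(ℝ, E) 𝓘(ℝ, ℝ) (H p.2) (u p) :=
    ((hH.smooth.comp (contMDiff_const.prodMk contMDiff_id) :
      ContMDiff 𝓘(ℝ, E) 𝓘(ℝ, ℝ) ∞ (H p.2)).mdifferentiableAt (by norm_num))
  have h1 : HasFDerivAt (fun s => H p.2 (u (s, p.2)))
      ((mfderiv 𝓘(ℝ, E) 𝓘(ℝ, ℝ) (H p.2) (u p) : E →L[ℝ] ℝ).comp
        (mfderiv 𝓘(ℝ, ℝ) 𝓘(ℝ, E) (fun s : ℝ => u (s, p.2)) p.1 : ℝ →L[ℝ] E)) p.1 :=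
    (HasMFDerivAt.comp p.1 hHt.hasMFDerivAt hus.hasMFDerivAt).hasFDerivAt
  exact HasFDerivAt.hasDerivAt (𝕜 := ℝ) (F := ℝ) h1

/-- The function is the τ-derivative of the smooth real function H(t, u(τ, t)), so continuity of ∂τ
u as a bundle-valued map is never needed. -/
theorem IsPiecewiseSmoothCylinder.continuousOn_differential (hH : IsPeriodicHamiltonian E H)
    (hu : IsPiecewiseSmoothCylinder E u) :
    ContinuousOn (fun p : ℝ × ℝ => differential (H p.2) (u p) (partialTau E u p))
      {p | p.1 ≠ 0} := by
  have hc := hu.contDiffOn_hamiltonian hH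
  refine ((hc.continuousOn_fderiv_of_isOpen isOpen_fst_ne_zero (by norm_num)).clm_apply
    (continuousOn_const (c := ((1 : ℝ), (0 : ℝ))))).congr fun p hp => ?_
  have hf : HasFDerivAt (fun p : ℝ × ℝ => H p.2 (u p)) _ (p.1, p.2) :=
    ((hc.contDiffAt (isOpen_fst_ne_zero.mem_nhds hp)).differentiableAt (by norm_num)).hasFDerivAt
  have h2 := (hf.comp p.1 (hasFDerivAt_prodMk_left p.1 p.2)).hasDerivAt
  refine (hu.hasDerivAt_hamiltonian hH hp).unique (h2.congr_deriv ?_)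
  simp

theorem IsPeriodicHamiltonian.continuous_uncurry (hH : IsPeriodicHamiltonian E H) :
    Continuous fun p : ℝ × M => H p.1 p.2 :=
  hH.smooth.continuous

theorem IsPiecewiseSmoothCylinder.continuous_slice (hH : IsPeriodicHamiltonian E H)
    (hu : IsPiecewiseSmoothCylinder E u) {τ : ℝ} (hτ : τ ≠ 0) :
    Continuous fun t => H t (u (τ, t)) :=
  (hu.contDiffOn_hamiltonian hH).continuousOn.comp_continuous
    (f := fun t : ℝ => (τ, t)) (by fun_prop) fun _ => hτ

/-- Convergence of the cylinder to a loop gives convergence of the circle averages of the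
Hamiltonian. -/
theorem IsPiecewiseSmoothCylinder.tendsto_average [CompactSpace M]
    (hH : IsPeriodicHamiltonian E H) (hu : IsPiecewiseSmoothCylinder E u) {l : Filter ℝ}
    [l.IsCountablyGenerated] (hl : ∀ᶠ τ in l, τ ≠ 0) {z : ℝ → M} (hz : ConvergesTo u l z) :
    Tendsto (fun τ => ∫ t in (0 : ℝ)..1, H t (u (τ, t))) l
      (𝓝 (∫ t in (0 : ℝ)..1, H t (z t))) := by
  -- A bound on [0, 1] × M provides the constant dominating function.
  obtain ⟨C, hC⟩ := ((isCompact_Icc (a := (0 : ℝ)) (b := 1)).prod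
    (isCompact_univ (X := M))).exists_bound_of_continuousOn hH.continuous_uncurry.continuousOn
  refine intervalIntegral.tendsto_integral_filter_of_dominated_convergence (fun _ => C) ?_ ?_ ?_ ?_
  · filter_upwards [hl] with τ hτ
    exact (hu.continuous_slice hH hτ).aestronglyMeasurable
  · refine Eventually.of_forall fun τ => Eventually.of_forall fun t ht => ?_
    rw [uIoc_of_le zero_le_one] at ht
    exact hC (t, u (τ, t)) ⟨Ioc_subset_Icc_self ht, mem_univ _⟩
  · exact intervalIntegrable_const
  · refine Eventually.of_forall fun t _ => ?_
    have h1 : Tendsto (fun τ => u (τ, t)) l (𝓝 (z t)) :=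
      (hz t).comp (tendsto_id.prodMk (tendsto_const_nhds (x := t)))
    have h2 : Continuous (H t) := hH.continuous_uncurry.comp (by fun_prop : Continuous fun x => (t, x))
    exact (h2.tendsto (z t)).comp h1

theorem IsPeriodicHamiltonian.continuous_iSup [CompactSpace M] (hH : IsPeriodicHamiltonian E H) :
    Continuous fun t => ⨆ x : M, H t x := by
  have := isCompact_univ.continuous_sSup (f := H) hH.continuous_uncurry
  simpa only [image_univ, sSup_range] using this

theorem IsPeriodicHamiltonian.neg (hH : IsPeriodicHamiltonian E H) :
    IsPeriodicHamiltonian E fun t x => -H t x where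
  smooth := hH.smooth.neg
  periodic t x := congrArg _ (hH.periodic t x)

theorem IsPeriodicHamiltonian.le_iSup [CompactSpace M] (hH : IsPeriodicHamiltonian E H)
    (t : ℝ) (x : M) : H t x ≤ ⨆ y : M, H t y :=
  le_ciSup (isCompact_range (hH.continuous_uncurry.comp
    (by fun_prop : Continuous fun x => (t, x)))).bddAbove x

/-- A limit of circle averages of `H` is at most `∫ max H`. -/
theorem IsPiecewiseSmoothCylinder.average_limit_le [CompactSpace M]
    (hH : IsPeriodicHamiltonian E H) (hu : IsPiecewiseSmoothCylinder E u) {l : Filter ℝ} [l.NeBot]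
    (hl : ∀ᶠ τ in l, τ ≠ 0) {L : ℝ}
    (hL : Tendsto (fun τ => ∫ t in (0 : ℝ)..1, H t (u (τ, t))) l (𝓝 L)) :
    L ≤ ∫ t in (0 : ℝ)..1, ⨆ x : M, H t x := by
  refine le_of_tendsto hL (hl.mono fun τ hτ => ?_)
  exact intervalIntegral.integral_mono_on zero_le_one
    ((hu.continuous_slice hH hτ).intervalIntegrable _ _)
    (hH.continuous_iSup.intervalIntegrable _ _) fun t _ => hH.le_iSup t _

variable [FiniteDimensional ℝ E] [IsManifold 𝓘(ℝ, E) ∞ M] {Ω : SymplecticForm E M}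
  {J : ℝ → ∀ x : M, TangentSpace 𝓘(ℝ, E) x →L[ℝ] TangentSpace 𝓘(ℝ, E) x}

/-- On each side of the jump, the area of a Floer cylinder is its energy minus the variation of
the averaged Hamiltonian, and these averages converge at the jump. -/
theorem IsPiecewiseSmoothCylinder.half_cylinder [CompactSpace M]
    (hH : IsPeriodicHamiltonian E H) (hu : IsPiecewiseSmoothCylinder E u)
    (hJ : IsCompatibleFamily Ω J) {S : Set ℝ} (hS : S.OrdConnected) (hSo : IsOpen S)
    (hS0 : ∀ τ ∈ S, τ ≠ 0) {e : ℝ × ℝ → ℝ} (he : IntegrableOn e (univ ×ˢ Ioc 0 1))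
    (heS : ∀ τ ∈ S, ∀ t, e (τ, t) = normSq Ω (J t (u (τ, t))) (partialTau E u (τ, t)))
    (hsol : ∀ τ ∈ S, ∀ t, partialTau E u (τ, t) + J t (u (τ, t))
      (partialT E u (τ, t) - hamiltonianVectorField Ω (H t) (u (τ, t))) = 0)
    {c : ℝ} (hc : c ∈ S) (hcS : uIcc c 0 ⊆ insert 0 S) :
    (∀ a ∈ S, ∀ b ∈ S, cylinderArea Ω u a b = (∫ τ in a..b, ∫ t in Ioc (0 : ℝ) 1, e (τ, t)) -
      ((∫ t in (0 : ℝ)..1, H t (u (b, t))) - ∫ t in (0 : ℝ)..1, H t (u (a, t)))) ∧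
    ∃ L, Tendsto (fun τ => ∫ t in (0 : ℝ)..1, H t (u (τ, t))) (𝓝[uIcc c 0 ∩ S] 0) (𝓝 L) := by
  have hsub : S ×ˢ (univ : Set ℝ) ⊆ {p : ℝ × ℝ | p.1 ≠ 0} := fun p hp => hS0 _ hp.1
  have hd := (hu.continuousOn_differential hH).mono hsub
  have hh := (hu.contDiffOn_hamiltonian hH).continuousOn.mono hsub
  have hder : ∀ τ ∈ S, ∀ t, HasDerivAt (fun s => H t (u (s, t)))
      (differential (H t) (u (τ, t)) (partialTau E u (τ, t))) τ := fun τ hτ t =>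
    hu.hasDerivAt_hamiltonian hH (p := (τ, t)) (hS0 τ hτ)
  refine ⟨fun a ha b hb => ?_, ?_⟩
  · rw [← integral_integral_sub_partial hS hd hh hder he ha hb]
    refine intervalIntegral.integral_congr fun τ hτ => ?_
    refine intervalIntegral.integral_congr fun t _ => ?_
    have hτS := hS.uIcc_subset ha hb hτ
    refine (hJ.floer_identities t (u (τ, t)) (H t) _ _ (hsol τ hτS t)).1.trans ?_
    dsimp only
    rw [heS τ hτS t]
  · obtain ⟨K, hK⟩ := exists_differential_sq_le hJ hH
    refine exists_tendsto_average hS hSo hd hh hder he (K := |K|) ?_ hc hcS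
    intro τ hτ t ht
    have h1 := hK t (Ioc_subset_Icc_self ht) (u (τ, t)) (partialTau E u (τ, t))
    rw [← heS τ hτ t] at h1
    have h0 : 0 ≤ e (τ, t) := by
      rw [heS τ hτ t]; exact hJ.normSq_nonneg _ _ _
    -- It remains to see K e ≤ (|K| + e)², which holds since e ≥ 0.
    refine abs_le_of_sq_le_sq (h1.trans ?_) (by positivity)
    nlinarith [le_abs_self K, abs_nonneg K, sq_nonneg (|K|), sq_nonneg (e (τ, t)),
      mul_nonneg (abs_nonneg K) h0, mul_le_mul_of_nonneg_right (le_abs_self K) h0]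

theorem jump_of_neg {α : Sort*} (a b : α) {τ : ℝ} (hτ : τ < 0) : jump a b τ = a := if_pos hτ

theorem jump_of_pos {α : Sort*} (a b : α) {τ : ℝ} (hτ : 0 < τ) : jump a b τ = b :=
  if_neg hτ.not_gt

omit [FiniteDimensional ℝ E] in
theorem IsCompatibleFamily.jump
    {J₀ J₁ : ℝ → ∀ x : M, TangentSpace 𝓘(ℝ, E) x →L[ℝ] TangentSpace 𝓘(ℝ, E) x}
    (hJ₀ : IsCompatibleFamily Ω J₀) (hJ₁ : IsCompatibleFamily Ω J₁) (τ : ℝ) :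
    IsCompatibleFamily Ω (JumpingFloer.jump J₀ J₁ τ) := by
  unfold JumpingFloer.jump
  split_ifs <;> assumption

/-- The equation makes the two terms of the energy density equal off the null line τ = 0, so each is
half of an integrable function. -/
theorem HasFiniteEnergy.integrableOn_normSq_partialTau {F : ℝ → M → ℝ}
    {J₀ J₁ : ℝ → ∀ x : M, TangentSpace 𝓘(ℝ, E) x →L[ℝ] TangentSpace 𝓘(ℝ, E) x}
    (hJ₀ : IsCompatibleFamily Ω J₀) (hJ₁ : IsCompatibleFamily Ω J₁)
    (hsol : SolvesJumpingEquation Ω H F J₀ J₁ u) (henergy : HasFiniteEnergy Ω H F J₀ J₁ u) :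
    IntegrableOn (fun p : ℝ × ℝ => normSq Ω (JumpingFloer.jump J₀ J₁ p.1 p.2 (u p))
      (partialTau E u p)) (univ ×ˢ Ioc 0 1) := by
  refine (Integrable.const_mul henergy (1 / 2)).congr ?_
  have h0 : ∀ᵐ p : ℝ × ℝ, p.1 ≠ 0 := by
    have : ∀ᵐ τ : ℝ, τ ≠ 0 := by simp [ae_iff]
    exact Measure.quasiMeasurePreserving_fst.ae this
  filter_upwards [ae_restrict_of_ae h0] with p hp
  have := ((hJ₀.jump hJ₁ p.1).floer_identities p.2 (u p) (JumpingFloer.jump H F p.1 p.2) _ _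
    (hsol p hp)).2
  simp only [jumpVectorField]
  rw [this]
  ring

end Cylinder

end JumpingFloer

end

/-! ### Assembly of the energy estimate -/

theorem mainTheorem4 {E : Type*} [NormedAddCommGroup E] [NormedSpace ℝ E] [FiniteDimensional ℝ E]
    {M : Type*} [TopologicalSpace M] [ChartedSpace E M] [IsManifold 𝓘(ℝ, E) ∞ M]
    [CompactSpace M] [T2Space M]
    (Ω : JumpingFloer.SymplecticForm E M)
    (H F : ℝ → M → ℝ)
    (hH : JumpingFloer.IsPeriodicHamiltonian E H)
    (hF : JumpingFloer.IsPeriodicHamiltonian E F)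
    (J₀ J₁ : ℝ → ∀ x : M, TangentSpace 𝓘(ℝ, E) x →L[ℝ] TangentSpace 𝓘(ℝ, E) x)
    (hJ₀ : JumpingFloer.IsCompatibleFamily Ω J₀)
    (hJ₁ : JumpingFloer.IsCompatibleFamily Ω J₁)
    (wminus wplus : ℂ → M)
    (hwminus : JumpingFloer.IsSmoothDisc E wminus)
    (hwplus : JumpingFloer.IsSmoothDisc E wplus)
    (hcritminus : JumpingFloer.IsCriticalPoint Ω H wminus)
    (hcritplus : JumpingFloer.IsCriticalPoint Ω F wplus)
    (u : ℝ × ℝ → M)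
    (hu : JumpingFloer.IsPiecewiseSmoothCylinder E u)
    (hsol : JumpingFloer.SolvesJumpingEquation Ω H F J₀ J₁ u)
    (henergy : JumpingFloer.HasFiniteEnergy Ω H F J₀ J₁ u)
    (hminus : JumpingFloer.ConvergesTo u atBot (JumpingFloer.boundaryLoop wminus))
    (hplus : JumpingFloer.ConvergesTo u atTop (JumpingFloer.boundaryLoop wplus)) :
    ∃ Aminus Aplus : ℝ,
      JumpingFloer.HasNegativeArea Ω u Aminus ∧
      JumpingFloer.HasPositiveArea Ω u Aplus ∧
      IntegrableOn (fun p : ℝ × ℝ => JumpingFloer.normSq Ω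
        (JumpingFloer.jump J₀ J₁ p.1 p.2 (u p)) (JumpingFloer.partialTau E u p))
        (univ ×ˢ Ioc 0 1) ∧
      (JumpingFloer.discArea Ω wminus + Aminus + Aplus - JumpingFloer.discArea Ω wplus = 0 →
        ∫ p in (univ : Set ℝ) ×ˢ Ioc (0 : ℝ) 1, JumpingFloer.normSq Ω
            (JumpingFloer.jump J₀ J₁ p.1 p.2 (u p)) (JumpingFloer.partialTau E u p) ≤
          JumpingFloer.action Ω H wminus - JumpingFloer.action Ω F wplus +
            (∫ t in (0 : ℝ)..1, ⨆ x : M, H t x) + ∫ t in (0 : ℝ)..1, -⨅ x : M, F t x) := by 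
  have hepart := JumpingFloer.HasFiniteEnergy.integrableOn_normSq_partialTau hJ₀ hJ₁ hsol henergy
  obtain ⟨hareaN, L₀, hL₀⟩ := hu.half_cylinder hH hJ₀ (S := Iio 0) ordConnected_Iio isOpen_Iio
    (fun τ hτ => ne_of_lt hτ) hepart
    (fun τ hτ t => by simp only [JumpingFloer.jump_of_neg _ _ hτ])
    (fun τ hτ t => by
      have := hsol (τ, t) (ne_of_lt hτ)
      simpa only [JumpingFloer.jumpVectorField, JumpingFloer.jump_of_neg _ _ hτ] using this)
    (c := -1) (by simp) (by
      rw [uIcc_of_le (by norm_num)]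
      exact fun x hx => (hx.2.eq_or_lt).imp id id)
  obtain ⟨hareaP, L₁, hL₁⟩ := hu.half_cylinder hF hJ₁ (S := Ioi 0) ordConnected_Ioi isOpen_Ioi
    (fun τ hτ => ne_of_gt hτ) hepart
    (fun τ hτ t => by simp only [JumpingFloer.jump_of_pos _ _ hτ])
    (fun τ hτ t => by
      have := hsol (τ, t) (ne_of_gt hτ)
      simpa only [JumpingFloer.jumpVectorField, JumpingFloer.jump_of_pos _ _ hτ] using this)
    (c := 1) (by simp) (by
      rw [uIcc_of_ge (by norm_num)]
      exact fun x hx => (hx.1.eq_or_lt').imp id id)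
  set e : ℝ × ℝ → ℝ := fun p => JumpingFloer.normSq Ω
    (JumpingFloer.jump J₀ J₁ p.1 p.2 (u p)) (JumpingFloer.partialTau E u p) with he
  have hN0 : 𝓝[uIcc (-1 : ℝ) 0 ∩ Iio 0] 0 = 𝓝[<] (0 : ℝ) := by
    rw [uIcc_of_le (by norm_num)]
    exact nhdsWithin_inter_of_mem (mem_of_superset (Ioo_mem_nhdsLT (by norm_num : (-1 : ℝ) < 0))
      Ioo_subset_Icc_self)
  have hP0 : 𝓝[uIcc (1 : ℝ) 0 ∩ Ioi 0] 0 = 𝓝[>] (0 : ℝ) := by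
    rw [uIcc_of_ge (by norm_num)]
    exact nhdsWithin_inter_of_mem (mem_of_superset (Ioo_mem_nhdsGT (by norm_num : (0 : ℝ) < 1))
      Ioo_subset_Icc_self)
  rw [hN0] at hL₀
  rw [hP0] at hL₁
  have hne₀ : ∀ᶠ τ : ℝ in 𝓝[<] 0, τ ≠ 0 := by
    filter_upwards [self_mem_nhdsWithin] with τ hτ using ne_of_lt hτ
  have hne₁ : ∀ᶠ τ : ℝ in 𝓝[>] 0, τ ≠ 0 := by
    filter_upwards [self_mem_nhdsWithin] with τ hτ using ne_of_gt hτ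
  have hbot := hu.tendsto_average hH ((eventually_lt_atBot 0).mono fun τ => ne_of_lt) hminus
  have htop := hu.tendsto_average hF ((eventually_gt_atTop 0).mono fun τ => ne_of_gt) hplus
  have hprod := hepart
  rw [IntegrableOn, Measure.volume_eq_prod, ← Measure.prod_restrict, Measure.restrict_univ]
    at hprod
  have hE : Integrable fun τ => ∫ t in Ioc (0 : ℝ) 1, e (τ, t) := hprod.integral_prod_left
  refine ⟨_, _, JumpingFloer.tendsto_integral_negative hE hareaN hbot hL₀,
    JumpingFloer.tendsto_integral_positive hE hareaP hL₁ htop, hepart, fun harea => ?_⟩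
  -- The circle τ = 0 has measure zero, so the value of `jump` there does not affect the energy.
  have htotal : ∫ p in (univ : Set ℝ) ×ˢ Ioc (0 : ℝ) 1, e p =
      (∫ τ in Iio 0, ∫ t in Ioc (0 : ℝ) 1, e (τ, t)) +
        ∫ τ in Ioi 0, ∫ t in Ioc (0 : ℝ) 1, e (τ, t) := by
    rw [Measure.volume_eq_prod, ← Measure.prod_restrict, Measure.restrict_univ,
      integral_prod _ hprod, ← integral_Iic_eq_integral_Iio]
    exact (intervalIntegral.integral_Iic_add_Ioi hE.integrableOn hE.integrableOn).symm
  have hle₀ := hu.average_limit_le hH hne₀ hL₀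
  -- The lower bound of L₁ by ∫ min F is the upper bound applied to -F.
  have hle₁ := hu.average_limit_le hF.neg hne₁ (L := -L₁) (by
    simpa only [intervalIntegral.integral_neg] using hL₁.neg)
  have hsup : ∀ t, ⨆ x : M, -F t x = -⨅ x : M, F t x := fun t => by
    rw [iInf, Real.sInf_def, neg_neg, iSup, Set.neg_range]
  simp only [hsup] at hle₁
  rw [htotal]
  simp only [JumpingFloer.action]
  -- Adding the two area formulas cancels the disc areas and asymptotic averages against the
  -- actions, leaving L₀ - L₁ to be bounded by `hle₀` and `hle₁`.
  linarith
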